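/- Let $\Delta$ be the simplex category, $m\ge 0$, $\vec\jmath=(j_1,\dots,j_m)\in\mathbb{N}^m$, and let $\Delta^{\le k}\subset\Delta$ be the full subcategory on $[0],\dots,[k]$. An $m$-cosimplicial space is a functor $X\colon \Delta^m\to \mathrm{Top}$. Its partial totalization $\operatorname{Tot}^{\vec\jmath}X$ is either (a) the space of families of continuous maps $\Delta^{p_1}\times\cdots\times\Delta^{p_m}\to X^{(p_1,\dots,p_m)}$, $p_i\le j_i$, that are compatible with all cofaces and codegeneracies in every direction, as a subspace of the product of the mapping spaces (the definition used for fibrant $X$), or (b) the homotopy limit of the restriction of $X$ to $\Delta^{\le j_1}\times\cdots\times\Delta^{\le j_m}$ (the definition used for arbitrary $X$). For $k\ge 0$ let $\operatorname{Tot}_i^{k}$ denote the $k$-th partial totalization in the $i$-th variable alone, taken in the sense of (a) or (b) respectively; it turns a multicosimplicial space into one in the remaining variables. Then, for each of the two definitions and for every permutation $\sigma$ of $\{1,\dots,m\}$, there is a homotopy equivalence, natural in the $m$-cosimplicial space $X$, $$\operatorname{Tot}^{\vec\jmath}X\;\simeq\;\operatorname{Tot}_{\sigma(1)}^{j_{\sigma(1)}}\operatorname{Tot}_{\sigma(2)}^{j_{\sigma(2)}}\cdots\operatorname{Tot}_{\sigma(m)}^{j_{\sigma(m)}}X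 .$$ In particular $\operatorname{Tot}^{\vec\jmath}X\simeq\operatorname{Tot}_1^{j_1}\operatorname{Tot}_2^{j_2}\cdots\operatorname{Tot}_m^{j_m}X$, and up to equivalence the order of the $\operatorname{Tot}_i^{j_i}$ does not matter. -/

import Mathlib

open CategoryTheory

universe u

namespace MultiTot

/-- The cosimplicial simplex `Δ^•`, whose `p`-th space is the standard topological `p`-simplex. -/
noncomputable def stdCosimplex : SimplexCategory ⥤ TopCat.{0} := SimplexCategory.toTop₀

/-! ### The space of natural maps between two diagrams of spaces -/

/-- The space of natural maps `D ⟶ X` between two diagrams of topological spaces: a subspace of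
the product of the mapping spaces `Map (D c, X c)` (with their compact-open topologies). -/
def NatMaps {C : Type} [SmallCategory C] (D : C ⥤ TopCat.{0}) (X : C ⥤ TopCat.{u}) : Type u :=
  {f : ∀ c : C, C(D.obj c, X.obj c) //
    ∀ ⦃c d : C⦄ (φ : c ⟶ d), (X.map φ).hom.comp (f c) = (f d).comp (D.map φ).hom}

instance {C : Type} [SmallCategory C] (D : C ⥤ TopCat.{0}) (X : C ⥤ TopCat.{u}) :
    TopologicalSpace (NatMaps D X) :=
  inferInstanceAs (TopologicalSpace {f : ∀ c : C, C(D.obj c, X.obj c) //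
    ∀ ⦃c d : C⦄ (φ : c ⟶ d), (X.map φ).hom.comp (f c) = (f d).comp (D.map φ).hom})

/-- Postcomposition with a map of diagrams `X ⟶ Y`. -/
def NatMaps.map {C : Type} [SmallCategory C] (D : C ⥤ TopCat.{0}) {X Y : C ⥤ TopCat.{u}}
    (η : X ⟶ Y) : C(NatMaps D X, NatMaps D Y) where
  toFun f := ⟨fun c => (η.app c).hom.comp (f.1 c), fun c d φ => by
    have h1 : (Y.map φ).hom.comp (η.app c).hom = (η.app d).hom.comp (X.map φ).hom := by
      rw [← TopCat.hom_comp, ← TopCat.hom_comp, η.naturality]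
    rw [← ContinuousMap.comp_assoc, h1, ContinuousMap.comp_assoc, f.2 φ,
      ContinuousMap.comp_assoc]⟩
  continuous_toFun := by
    refine Continuous.subtype_mk (continuous_pi fun c => ?_) _
    exact (ContinuousMap.continuous_postcomp _).comp
      ((continuous_apply c).comp continuous_subtype_val)

/-- `X ↦ NatMaps D X` as a functor. -/
def natMapsFunctor {C : Type} [SmallCategory C] (D : C ⥤ TopCat.{0}) :
    (C ⥤ TopCat.{u}) ⥤ TopCat.{u} where
  obj X := TopCat.of (NatMaps D X)
  map η := TopCat.ofHom (NatMaps.map D η)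
  map_id _ := rfl
  map_comp _ _ := rfl

/-! ### Homotopy limits of spaces -/

/-- The Bousfield-Kan homotopy limit of a diagram `X : C ⥤ Top`, that is, the space of natural maps
from `c ↦ |N(C/c)|` to `X`. An `n`-simplex of `N(C/c)` is a chain `s 0 ⟶ ⋯ ⟶ s n` in `C` together
with a morphism `s n ⟶ c`, so by naturality such a map amounts to maps `f s : Δⁿ ⟶ X (s n)`, one for
every chain `s`, that are compatible with all simplicial operators. (Equivalently, this is the
totalization of the cosimplicial replacement `n ↦ ∏ₛ X (s n)` of `X`.) -/
def Holim {C : Type} [SmallCategory C] (X : C ⥤ TopCat.{u}) : Type u :=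
  {f : ∀ (n : SimplexCategory) (s : Fin (n.len + 1) ⥤ C),
      C(stdCosimplex.obj n, X.obj (s.obj (Fin.last n.len))) //
    ∀ ⦃k n : SimplexCategory⦄ (α : k ⟶ n) (s : Fin (n.len + 1) ⥤ C),
      (X.map (s.map (homOfLE (Fin.le_last (α.toOrderHom (Fin.last k.len)))))).hom.comp
          (f k (α.toOrderHom.monotone.functor ⋙ s)) =
        (f n s).comp (stdCosimplex.map α).hom}

instance {C : Type} [SmallCategory C] (X : C ⥤ TopCat.{u}) : TopologicalSpace (Holim X) :=
  inferInstanceAs (TopologicalSpace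
    {f : ∀ (n : SimplexCategory) (s : Fin (n.len + 1) ⥤ C),
      C(stdCosimplex.obj n, X.obj (s.obj (Fin.last n.len))) //
    ∀ ⦃k n : SimplexCategory⦄ (α : k ⟶ n) (s : Fin (n.len + 1) ⥤ C),
      (X.map (s.map (homOfLE (Fin.le_last (α.toOrderHom (Fin.last k.len)))))).hom.comp
          (f k (α.toOrderHom.monotone.functor ⋙ s)) =
        (f n s).comp (stdCosimplex.map α).hom})

/-- The map of homotopy limits induced by a map of diagrams `X ⟶ Y`. -/
noncomputable def Holim.map {C : Type} [SmallCategory C] {X Y : C ⥤ TopCat.{u}} (η : X ⟶ Y) :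
    C(Holim X, Holim Y) where
  toFun f := ⟨fun n s => (η.app _).hom.comp (f.1 n s), fun k n α s => by
    have h1 := congrArg TopCat.Hom.hom
      (η.naturality (s.map (homOfLE (Fin.le_last (α.toOrderHom (Fin.last k.len))))))
    rw [TopCat.hom_comp, TopCat.hom_comp] at h1
    have h2 := f.2 α s
    refine (ContinuousMap.comp_assoc _ _ _).symm.trans ?_
    refine (congrArg (fun g => ContinuousMap.comp g (f.1 k _)) h1.symm).trans ?_
    refine (ContinuousMap.comp_assoc _ _ _).trans ?_
    exact (congrArg (fun g => ContinuousMap.comp (η.app _).hom g) h2).trans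
      (ContinuousMap.comp_assoc _ _ _).symm⟩
  continuous_toFun := by
    refine Continuous.subtype_mk (continuous_pi fun n => continuous_pi fun s => ?_) _
    exact (ContinuousMap.continuous_postcomp _).comp
      ((continuous_apply s).comp ((continuous_apply n).comp continuous_subtype_val))

/-- The homotopy limit as a functor. -/
noncomputable def holimFunctor (C : Type) [SmallCategory C] : (C ⥤ TopCat.{u}) ⥤ TopCat.{u} where
  obj X := TopCat.of (Holim X)
  map η := TopCat.ofHom (Holim.map η)
  map_id _ := rfl
  map_comp _ _ := rfl

/-! ### Multicosimplicial spaces and their partial totalizations -/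

/-- Multicosimplicial spaces with variables indexed by `ι`: functors from a power of `Δ` to
spaces. For `ι = Fin m` these are the `m`-cosimplicial spaces. -/
abbrev MultiCosimplicialSpace (ι : Type) := (ι → SimplexCategory) ⥤ TopCat.{u}

/-- The inclusion of `Δ^{≤ j} = ∏ i, Δ^{≤ j i}`, where `Δ^{≤ k}` is the full subcategory
of `Δ` on `[0], …, [k]`. -/
def truncIncl {ι : Type} (j : ι → ℕ) :
    (∀ i, SimplexCategory.Truncated (j i)) ⥤ (ι → SimplexCategory) :=
  Functor.pi fun i => SimplexCategory.Truncated.inclusion (j i)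

/-- The multicosimplicial space `p ↦ ∏ i, Δ^{p i}`. -/
noncomputable def multiSimplex (ι : Type) : (ι → SimplexCategory) ⥤ TopCat.{0} where
  obj p := TopCat.of (∀ i, stdCosimplex.obj (p i))
  map φ := TopCat.ofHom
    ⟨fun x i => (stdCosimplex.map (φ i)).hom (x i), by fun_prop⟩
  map_id p := by
    ext x i
    change (stdCosimplex.map (𝟙 (p i))).hom (x i) = x i
    rw [stdCosimplex.map_id]
    rfl
  map_comp φ ψ := by
    ext x i
    change (stdCosimplex.map (φ i ≫ ψ i)).hom (x i) = _
    rw [stdCosimplex.map_comp]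
    rfl

/-- The partial totalization `Tot^j X` of a multicosimplicial space as the space of families of maps
`∏ i, Δ^{p i} ⟶ X^p`, `p ≤ j`, that are compatible with all cosimplicial operators. -/
noncomputable def mapTot {ι : Type} (j : ι → ℕ) :
    MultiCosimplicialSpace.{u} ι ⥤ TopCat.{u} :=
  (Functor.whiskeringLeft _ _ _).obj (truncIncl j) ⋙
    natMapsFunctor (truncIncl j ⋙ multiSimplex ι)

/-- The partial totalization `Tot^j X` of a multicosimplicial space as the homotopy limit of the
restriction of `X` to `Δ^{≤ j}`. -/
noncomputable def holimTot {ι : Type} (j : ι → ℕ) : MultiCosimplicialSpace.{u} ι ⥤ TopCat.{u} :=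
  (Functor.whiskeringLeft _ _ _).obj (truncIncl j) ⋙ holimFunctor _

/-- The partial totalization `Tot^k X` of a cosimplicial space as the space of families of maps
`Δ^p ⟶ X^p`, `p ≤ k`, that are compatible with all cosimplicial operators. -/
noncomputable def mapTotOne (k : ℕ) : (SimplexCategory ⥤ TopCat.{u}) ⥤ TopCat.{u} :=
  (Functor.whiskeringLeft _ _ _).obj (SimplexCategory.Truncated.inclusion k) ⋙
    natMapsFunctor (SimplexCategory.Truncated.inclusion k ⋙ stdCosimplex)

/-- The partial totalization `Tot^k X` of a cosimplicial space as the homotopy limit of the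
restriction of `X` to `Δ^{≤ k}`. -/
noncomputable def holimTotOne (k : ℕ) : (SimplexCategory ⥤ TopCat.{u}) ⥤ TopCat.{u} :=
  (Functor.whiskeringLeft _ _ _).obj (SimplexCategory.Truncated.inclusion k) ⋙ holimFunctor _

/-! ### Iterated partial totalizations -/

/-- Inserting a value for the variable `a`: from values `p` of the variables outside `a :: l` and a
value `q` of the variable `a`, one gets values of all the variables outside `l`. -/
def insertVar {ι : Type} [DecidableEq ι] (a : ι) (l : List ι) :
    ({i : ι // i ∉ a :: l} → SimplexCategory) × SimplexCategory ⥤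
      ({i : ι // i ∉ l} → SimplexCategory) :=
  Functor.pi' fun i =>
    if h : i.1 = a then CategoryTheory.Prod.snd _ _
    else CategoryTheory.Prod.fst _ _ ⋙
      Pi.eval _ ⟨i.1, fun hi => (List.mem_cons.1 hi).elim h i.2⟩

/-- A construction `T` on cosimplicial spaces, applied in the variable `a` to a multicosimplicial
space with variables outside `l`. The result has the variables outside `a :: l`. -/
def inVariable (T : (SimplexCategory ⥤ TopCat.{u}) ⥤ TopCat.{u})
    {ι : Type} [DecidableEq ι] (a : ι) (l : List ι) :
    MultiCosimplicialSpace.{u} {i : ι // i ∉ l} ⥤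
      MultiCosimplicialSpace.{u} {i : ι // i ∉ a :: l} :=
  (Functor.whiskeringLeft _ _ _).obj (insertVar a l) ⋙ Functor.curry ⋙
    (Functor.whiskeringRight _ _ _).obj T

/-- For `l = [a₁, …, aᵣ]`, the composite `T^{j a₁} ⋯ T^{j aᵣ}` in which `T^{j a}` is applied in the
variable `a`, the last one of the list first. The variables outside `l` remain. -/
def iterVariables (T : ℕ → (SimplexCategory ⥤ TopCat.{u}) ⥤ TopCat.{u})
    {ι : Type} [DecidableEq ι] (j : ι → ℕ) :
    (l : List ι) → MultiCosimplicialSpace.{u} ι ⥤ MultiCosimplicialSpace.{u} {i : ι // i ∉ l}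
  | [] => (Functor.whiskeringLeft _ _ _).obj
      (Functor.pi' fun i => Pi.eval _ ⟨i, List.not_mem_nil⟩)
  | a :: l => iterVariables T j l ⋙ inVariable (T (j a)) a l

/-- The iterated construction `T^{j (σ 0)} T^{j (σ 1)} ⋯ T^{j (σ (m - 1))} X`, in which
`T^{j (σ i)}` is applied in the variable `σ i`. No variable remains, so that the result is a
space. -/
def iterated (T : ℕ → (SimplexCategory ⥤ TopCat.{u}) ⥤ TopCat.{u})
    {m : ℕ} (j : Fin m → ℕ) (σ : Equiv.Perm (Fin m)) :
    MultiCosimplicialSpace.{u} (Fin m) ⥤ TopCat.{u} :=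
  iterVariables T j (List.ofFn σ) ⋙
    (evaluation _ _).obj fun i => (i.2 ((List.mem_ofFn' σ i.1).2 (σ.surjective i.1))).elim

/-- A continuous map that is a homotopy equivalence. -/
def IsHomotopyEquiv {A B : TopCat.{u}} (f : A ⟶ B) : Prop :=
  ∃ h : ContinuousMap.HomotopyEquiv A B, h.toFun = f.hom

end MultiTot

/-! Both comparisons are natural homeomorphisms; nothing is inverted only up to homotopy. Each is a
Fubini theorem for two factors, iterated over the variables. The iteration `exists_iterated_iso`
runs over lists: for any duplicate-free list of all variables, the product of the truncated
categories is isomorphic to the iterated binary product `TruncList`. The order of the list plays no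
role, which gives every `σ` at once.

For (a), Fubini is the exponential law for the locally compact simplices (`natMapsProdIso`), and the
product of all simplices is compared with the iterated binary product (`isIso_simplexProj`).

For (b), Fubini (`holimProdIso`) expresses that realization commutes with products of nerves. A
point of the iterated homotopy limit assigns maps on `Δⁿ × Δᵐ` to pairs of chains; restricting to
diagonals gives a point of the homotopy limit over `C × D`. Conversely, such a point prescribes
values on the simplices of `Δⁿ × Δᵐ`, and these must be glued. Three facts make this work: every
pair of points comes from one point of a single simplex (`exists_stdCosimplex_coupling`); two such
representations agree on a common simplex (`exists_stdCosimplex_equalizer`); and the finitely many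
simplices of dimension `n + m` map onto the product by a proper map, so continuity can be tested on
them (`continuous_of_comp_stdCosimplex_map`). -/

namespace MultiTot

/-! ### Monotone couplings of points of two simplices -/

/-- Two vectors `x` and `y` are the marginals of nonnegative weights on a chain of `N + 1` points
in the product of two finite linear orders. -/
def HasMonotoneCoupling (N : ℕ) {n m : ℕ} (x : Fin (n + 1) → ℝ) (y : Fin (m + 1) → ℝ) : Prop :=
  ∃ (z : Fin (N + 1) → ℝ) (α : Fin (N + 1) → Fin (n + 1)) (β : Fin (N + 1) → Fin (m + 1)),
    (∀ i, 0 ≤ z i) ∧ Monotone α ∧ Monotone β ∧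
      (∀ a, ∑ i with α i = a, z i = x a) ∧ ∀ b, ∑ i with β i = b, z i = y b

lemma HasMonotoneCoupling.symm {N n m : ℕ} {x : Fin (n + 1) → ℝ} {y : Fin (m + 1) → ℝ}
    (h : HasMonotoneCoupling N x y) : HasMonotoneCoupling N y x := by
  obtain ⟨z, α, β, hz, hα, hβ, hx, hy⟩ := h
  exact ⟨z, β, α, hz, hβ, hα, hy, hx⟩

lemma hasMonotoneCoupling_zero {m : ℕ} {x : Fin 1 → ℝ} {y : Fin (m + 1) → ℝ}
    (hy : ∀ b, 0 ≤ y b) (h : ∑ a, x a = ∑ b, y b) :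
    HasMonotoneCoupling (n := 0) m x y := by
  refine ⟨y, fun _ => 0, id, hy, monotone_const, monotone_id, fun a => ?_, fun b => ?_⟩
  · obtain rfl : a = 0 := Subsingleton.elim (α := Fin 1) a 0
    rw [Finset.filter_true_of_mem fun i _ => rfl, ← h]
    exact Fin.sum_univ_one x
  · simp [Finset.filter_eq']

lemma monotone_snoc_last {N n : ℕ} {α : Fin (N + 1) → Fin (n + 1)} (hα : Monotone α) :
    Monotone (Fin.snoc α (Fin.last n) : Fin (N + 2) → Fin (n + 1)) := by
  intro i i' h
  induction i' using Fin.lastCases with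
  | last => simpa using Fin.le_last _
  | cast i' =>
    induction i using Fin.lastCases with
    | last => exact absurd h (not_le.2 (Fin.castSucc_lt_last i'))
    | cast i => simpa using hα (Fin.castSucc_le_castSucc_iff.1 h)

lemma sum_filter_snoc {N n : ℕ} (α : Fin (N + 1) → Fin (n + 1)) (z : Fin (N + 1) → ℝ)
    (c : Fin (n + 1)) (w : ℝ) (a : Fin (n + 1)) :
    ∑ i with (Fin.snoc α c : Fin (N + 2) → Fin (n + 1)) i = a,
      (Fin.snoc z w : Fin (N + 2) → ℝ) i =
      ∑ i with α i = a, z i + if c = a then w else 0 := by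
  rw [Finset.sum_filter, Fin.sum_univ_castSucc, Finset.sum_filter]
  simp

/-- One greedy step: the mass `x (Fin.last _)` is placed at the top corner (last, last) and removed
from both marginals. This uses up the last vertex of `x`, and the new point lies above the rest of
the chain. -/
lemma HasMonotoneCoupling.succ {N n m : ℕ} {x : Fin (n + 2) → ℝ} {y : Fin (m + 1) → ℝ}
    (hx : 0 ≤ x (Fin.last _))
    (h : HasMonotoneCoupling N (fun a : Fin (n + 1) => x a.castSucc)
      (y - Pi.single (Fin.last m) (x (Fin.last _)))) :
    HasMonotoneCoupling (n := n + 1) (N + 1) x y := by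
  obtain ⟨z, α, β, hz, hα, hβ, hx', hy'⟩ := h
  refine ⟨Fin.snoc z (x (Fin.last _)), Fin.snoc (fun i => (α i).castSucc) (Fin.last _),
    Fin.snoc β (Fin.last _), fun i => ?_, monotone_snoc_last fun i i' h => ?_,
    monotone_snoc_last hβ, fun a => ?_, fun b => ?_⟩
  · induction i using Fin.lastCases with
    | last => simpa using hx
    | cast i => simpa using hz i
  · exact Fin.castSucc_le_castSucc_iff.2 (hα h)
  · rw [sum_filter_snoc]
    induction a using Fin.lastCases with
    | last => simp [(Fin.castSucc_lt_last _).ne]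
    | cast a => simpa [(Fin.castSucc_lt_last _).ne'] using hx' a
  · rw [sum_filter_snoc, hy']
    by_cases hb : Fin.last m = b
    · subst hb; simp
    · simp [hb, Ne.symm hb]

/-- Greedy matching from the top corner: the smaller of the two last masses is removed each time,
which uses up one vertex. Hence at most `n + m` steps occur before one side is a single vertex. -/
lemma hasMonotoneCoupling {N n m : ℕ} (hN : n + m = N) {x : Fin (n + 1) → ℝ}
    {y : Fin (m + 1) → ℝ} (hx : ∀ a, 0 ≤ x a) (hy : ∀ b, 0 ≤ y b)
    (h : ∑ a, x a = ∑ b, y b) : HasMonotoneCoupling N x y := by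
  -- Stated before the induction and for all sizes, so that it can also be applied with `x` and `y`
  -- exchanged.
  have step : ∀ {N n m : ℕ} {x : Fin (n + 2) → ℝ} {y : Fin (m + 1) → ℝ}, (∀ a, 0 ≤ x a) →
      (∀ b, 0 ≤ y b) → ∑ a, x a = ∑ b, y b → x (Fin.last _) ≤ y (Fin.last _) →
      (∀ {x' : Fin (n + 1) → ℝ} {y' : Fin (m + 1) → ℝ}, (∀ a, 0 ≤ x' a) → (∀ b, 0 ≤ y' b) →
        ∑ a, x' a = ∑ b, y' b → HasMonotoneCoupling N x' y') →
      HasMonotoneCoupling (n := n + 1) (N + 1) x y := by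
    intro N n m x y hx hy h hxy ih
    refine .succ (hx _) (ih (fun a => hx _) (fun b => ?_) ?_)
    · by_cases hb : b = Fin.last m
      · subst hb; simpa using hxy
      · simpa [hb, Pi.single_apply] using hy b
    · rw [Fin.sum_univ_castSucc] at h
      simp [Finset.sum_sub_distrib, ← h]
  induction N generalizing n m with
  | zero =>
    obtain ⟨rfl, rfl⟩ : n = 0 ∧ m = 0 := by omega
    exact hasMonotoneCoupling_zero hy h
  | succ N ih =>
    match n, m, hN with
    | 0, m, hN =>
      obtain rfl : m = N + 1 := by omega
      exact hasMonotoneCoupling_zero hy h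
    | n + 1, 0, hN =>
      obtain rfl : n = N := by omega
      exact (hasMonotoneCoupling_zero hx h.symm).symm
    | n + 1, m + 1, hN =>
      rcases le_total (x (Fin.last _)) (y (Fin.last _)) with hxy | hxy
      · exact step hx hy h hxy fun hx' hy' h' => ih (by omega) hx' hy' h'
      · exact (step hy hx h.symm hxy fun hx' hy' h' => ih (by omega) hx' hy' h').symm

lemma stdSimplex_map_apply {X Y : Type*} [Fintype X] [Fintype Y] [DecidableEq Y] (f : X → Y)
    (z : stdSimplex ℝ X) (y : Y) : stdSimplex.map f z y = ∑ x with f x = y, z x := by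
  rw [stdSimplex.map_coe, FunOnFinite.linearMap_apply_apply]

/-- Any two points of simplices are the images of a point of one simplex. -/
lemma exists_stdSimplex_coupling {n m : ℕ} (x : stdSimplex ℝ (Fin (n + 1)))
    (y : stdSimplex ℝ (Fin (m + 1))) :
    ∃ (α : Fin (n + m + 1) →o Fin (n + 1)) (β : Fin (n + m + 1) →o Fin (m + 1))
      (z : stdSimplex ℝ (Fin (n + m + 1))),
      stdSimplex.map α z = x ∧ stdSimplex.map β z = y := by
  obtain ⟨z, α, β, hz, hα, hβ, hx, hy⟩ := hasMonotoneCoupling (N := n + m) rfl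
    (stdSimplex.zero_le x) (stdSimplex.zero_le y)
    ((stdSimplex.sum_eq_one x).trans (stdSimplex.sum_eq_one y).symm)
  refine ⟨⟨α, hα⟩, ⟨β, hβ⟩, ⟨z, hz, ?_⟩, ?_, ?_⟩
  · rw [← stdSimplex.sum_eq_one x, ← Finset.sum_fiberwise Finset.univ α z]
    exact Finset.sum_congr rfl fun a _ => hx a
  · ext a
    exact (stdSimplex_map_apply _ _ a).trans (hx a)
  · ext b
    exact (stdSimplex_map_apply _ _ b).trans (hy b)

/-! ### Interior points of faces -/

/-- Every point of a simplex lies in the interior of a face. -/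
lemma exists_stdSimplex_face {k : ℕ} (z : stdSimplex ℝ (Fin (k + 1))) :
    ∃ (l : ℕ) (γ : Fin (l + 1) →o Fin (k + 1)) (w : stdSimplex ℝ (Fin (l + 1))),
      (∀ i, 0 < w i) ∧ stdSimplex.map γ w = z := by
  -- The face is spanned by the support of `z`, enumerated in increasing order by `γ`.
  let S : Finset (Fin (k + 1)) := {i | 0 < z i}
  have hS : S.Nonempty := by
    by_contra hS
    have h0 : ∑ i, z i = 0 := Finset.sum_eq_zero fun i _ =>
      le_antisymm (not_lt.1 fun hi => hS ⟨i, by simpa [S] using hi⟩) (stdSimplex.zero_le z i)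
    rw [stdSimplex.sum_eq_one] at h0
    exact one_ne_zero h0
  obtain ⟨l, hl⟩ := Nat.exists_eq_succ_of_ne_zero hS.card_ne_zero
  let γ := S.orderEmbOfFin hl
  have hsum : ∀ f : Fin (k + 1) → ℝ, (∀ a, z a = 0 → f a = 0) → ∑ i, f (γ i) = ∑ a, f a := by
    intro f hf
    rw [← Finset.sum_image (s := Finset.univ) (g := γ) (f := f) γ.injective.injOn]
    refine Finset.sum_subset (Finset.subset_univ _) fun a _ ha => hf a ?_
    refine le_antisymm (not_lt.1 fun h => ha ?_) (stdSimplex.zero_le z a)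
    have : a ∈ Set.range γ := by
      rw [Finset.range_orderEmbOfFin]
      simpa [S] using h
    simpa using this
  refine ⟨l, γ.toOrderHom, ⟨fun i => z (γ i), fun i => stdSimplex.zero_le z _, ?_⟩, fun i => ?_, ?_⟩
  · rw [hsum z fun _ h => h, stdSimplex.sum_eq_one]
  · exact (Finset.mem_filter.1 (S.orderEmbOfFin_mem hl i)).2
  · ext a
    rw [stdSimplex_map_apply, Finset.sum_filter]
    refine (hsum (fun b => if b = a then z b else 0) fun b hb => by simp [hb]).trans ?_
    simp

/-- A monotone map between the vertices of simplices is determined by the image of an interior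
point. -/
lemma orderHom_le_of_stdSimplex_map_eq {k p : ℕ} {δ ε : Fin (k + 1) →o Fin (p + 1)}
    {z : stdSimplex ℝ (Fin (k + 1))} (hz : ∀ i, 0 < z i)
    (h : stdSimplex.map δ z = stdSimplex.map ε z) : ε ≤ δ := by
  intro i
  by_contra hi
  have hi : δ i < ε i := not_le.1 hi
  -- Compare the mass at vertices up to `δ i`. Under `ε` only indices below `i` contribute; under
  -- `δ` all of these do, and so does `i`, whose mass is positive.
  have key : ∀ θ : Fin (k + 1) →o Fin (p + 1),
      ∑ a with a ≤ δ i, stdSimplex.map θ z a = ∑ i' with θ i' ≤ δ i, z i' := by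
    intro θ
    simp_rw [stdSimplex_map_apply]
    rw [← Finset.sum_fiberwise_of_maps_to (g := θ) (t := {a | a ≤ δ i})
      (fun i' hi' => by simpa using hi')]
    refine Finset.sum_congr rfl fun a ha => Finset.sum_congr ?_ fun _ _ => rfl
    ext i'
    simp only [Finset.mem_filter, Finset.mem_univ, true_and] at ha ⊢
    exact ⟨fun h => ⟨h ▸ ha, h⟩, fun h => h.2⟩
  have hsum : ∑ i' with δ i' ≤ δ i, z i' = ∑ i' with ε i' ≤ δ i, z i' := by
    rw [← key δ, ← key ε, h]
  have hlt : ∀ i', ε i' ≤ δ i → i' < i := fun i' h' =>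
    lt_of_not_ge fun hle => absurd ((ε.monotone hle).trans h') (not_le.2 hi)
  refine absurd hsum.symm (Finset.sum_lt_sum_of_subset (i := i) (fun i' hi' => ?_) (by simp)
    (by simpa using hi) (hz i) fun j _ _ => (hz j).le).ne
  simp only [Finset.mem_filter, Finset.mem_univ, true_and] at hi' ⊢
  exact δ.monotone (hlt i' hi').le

lemma orderHom_eq_of_stdSimplex_map_eq {k p : ℕ} {δ ε : Fin (k + 1) →o Fin (p + 1)}
    {z : stdSimplex ℝ (Fin (k + 1))} (hz : ∀ i, 0 < z i)
    (h : stdSimplex.map δ z = stdSimplex.map ε z) : δ = ε :=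
  le_antisymm (orderHom_le_of_stdSimplex_map_eq hz h.symm) (orderHom_le_of_stdSimplex_map_eq hz h)

/-! ### Products of two simplices as glued from their simplices -/

instance (n : SimplexCategory) : CompactSpace (stdCosimplex.obj n) :=
  inferInstanceAs (CompactSpace (stdSimplex ℝ (Fin (n.len + 1))))

instance (n : SimplexCategory) : T2Space (stdCosimplex.obj n) :=
  inferInstanceAs (T2Space (stdSimplex ℝ (Fin (n.len + 1))))

lemma stdCosimplex_map_comp_apply {k l n : SimplexCategory} (γ : l ⟶ k) (α : k ⟶ n)
    (w : stdCosimplex.obj l) :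
    stdCosimplex.map α (stdCosimplex.map γ w) = stdCosimplex.map (γ ≫ α) w := by
  rw [stdCosimplex.map_comp]
  rfl

lemma exists_stdCosimplex_coupling {n m : SimplexCategory} (x : stdCosimplex.obj n)
    (y : stdCosimplex.obj m) :
    ∃ (α : SimplexCategory.mk (n.len + m.len) ⟶ n) (β : SimplexCategory.mk (n.len + m.len) ⟶ m)
      (z : stdCosimplex.obj (SimplexCategory.mk (n.len + m.len))),
      stdCosimplex.map α z = x ∧ stdCosimplex.map β z = y := by
  obtain ⟨α, β, z, h⟩ := exists_stdSimplex_coupling x y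
  exact ⟨.mk α, .mk β, z, h⟩

/-- Every point of a simplex lies in a face on which simplicial operators are determined by the
image of the point. -/
lemma exists_stdCosimplex_face {k : SimplexCategory} (z : stdCosimplex.obj k) :
    ∃ (l : SimplexCategory) (δ : l ⟶ k) (w : stdCosimplex.obj l), stdCosimplex.map δ w = z ∧
      ∀ {p : SimplexCategory} {ε ε' : k ⟶ p}, stdCosimplex.map ε z = stdCosimplex.map ε' z →
        δ ≫ ε = δ ≫ ε' := by
  obtain ⟨l, δ, w, hw, hδ⟩ := exists_stdSimplex_face z
  have hδ' : stdCosimplex.map (X := .mk l) (Y := k) (.mk δ) w = z := hδ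
  refine ⟨.mk l, .mk δ, w, hδ', fun {p ε ε'} h => ?_⟩
  have key : stdCosimplex.map (X := .mk l) (.mk δ ≫ ε) w =
      stdCosimplex.map (X := .mk l) (.mk δ ≫ ε') w :=
    (stdCosimplex_map_comp_apply (l := .mk l) _ _ _).symm.trans
      ((congrArg (stdCosimplex.map ε) hδ').trans (h.trans
        ((congrArg (stdCosimplex.map ε') hδ').symm.trans
          (stdCosimplex_map_comp_apply (l := .mk l) _ _ _))))
  exact SimplexCategory.Hom.ext _ _ (orderHom_eq_of_stdSimplex_map_eq hw key)

/-- Two simplices of `Δⁿ × Δᵐ` through the same point: a coupling of `z` and `z'` puts both on one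
simplex, and on the face having the coupling point in its interior, operators with equal values at
that point coincide. -/
lemma exists_stdCosimplex_equalizer {k k' n m : SimplexCategory} {α : k ⟶ n} {α' : k' ⟶ n}
    {β : k ⟶ m} {β' : k' ⟶ m} {z : stdCosimplex.obj k} {z' : stdCosimplex.obj k'}
    (hα : stdCosimplex.map α z = stdCosimplex.map α' z')
    (hβ : stdCosimplex.map β z = stdCosimplex.map β' z') :
    ∃ (l : SimplexCategory) (γ : l ⟶ k) (γ' : l ⟶ k') (w : stdCosimplex.obj l),
      stdCosimplex.map γ w = z ∧ stdCosimplex.map γ' w = z' ∧ γ ≫ α = γ' ≫ α' ∧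
        γ ≫ β = γ' ≫ β' := by
  obtain ⟨γ₀, γ₀', w₀, rfl, rfl⟩ := exists_stdCosimplex_coupling z z'
  obtain ⟨l, δ, w, rfl, key⟩ := exists_stdCosimplex_face w₀
  refine ⟨l, δ ≫ γ₀, δ ≫ γ₀', w, ?_, ?_, ?_, ?_⟩
  · rw [stdCosimplex_map_comp_apply]
  · rw [stdCosimplex_map_comp_apply]
  · rw [Category.assoc, Category.assoc]
    exact key (by rwa [← stdCosimplex_map_comp_apply, ← stdCosimplex_map_comp_apply])
  · rw [Category.assoc, Category.assoc]
    exact key (by rwa [← stdCosimplex_map_comp_apply, ← stdCosimplex_map_comp_apply])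

/-- A family of functions on the simplices of `Δⁿ × Δᵐ`, glued to a function on `Δⁿ × Δᵐ`. -/
noncomputable def glue {n m : SimplexCategory} {Z : Type u}
    (h : ∀ (k : SimplexCategory), (k ⟶ n) → (k ⟶ m) → stdCosimplex.obj k → Z)
    (x : stdCosimplex.obj n) (y : stdCosimplex.obj m) : Z :=
  h _ (exists_stdCosimplex_coupling x y).choose
    (exists_stdCosimplex_coupling x y).choose_spec.choose
    (exists_stdCosimplex_coupling x y).choose_spec.choose_spec.choose

/-- The value does not depend on the chosen coupling, since any two representations of a point are
compared on a common simplex, where `hh` identifies the two values. -/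
lemma glue_map {n m : SimplexCategory} {Z : Type u}
    {h : ∀ (k : SimplexCategory), (k ⟶ n) → (k ⟶ m) → stdCosimplex.obj k → Z}
    (hh : ∀ ⦃l k : SimplexCategory⦄ (γ : l ⟶ k) (α : k ⟶ n) (β : k ⟶ m) (w : stdCosimplex.obj l),
      h l (γ ≫ α) (γ ≫ β) w = h k α β (stdCosimplex.map γ w))
    {k : SimplexCategory} (α : k ⟶ n) (β : k ⟶ m) (z : stdCosimplex.obj k) :
    glue h (stdCosimplex.map α z) (stdCosimplex.map β z) = h k α β z := by
  have hc := (exists_stdCosimplex_coupling (stdCosimplex.map α z)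
    (stdCosimplex.map β z)).choose_spec.choose_spec.choose_spec
  obtain ⟨l, γ, γ', w, hγ, hγ', h1, h2⟩ := exists_stdCosimplex_equalizer hc.1 hc.2
  rw [glue, ← hγ, ← hh, h1, h2, hh, hγ']

/-- A function on `B × Δⁿ × Δᵐ` is continuous if it is so on `B × Δᵏ` for every simplex of
`Δⁿ × Δᵐ`. -/
lemma continuous_of_comp_stdCosimplex_map {n m : SimplexCategory} {B : Type*} {Z : Type*}
    [TopologicalSpace B] [TopologicalSpace Z]
    {f : B × stdCosimplex.obj n × stdCosimplex.obj m → Z}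
    (hf : ∀ (k : SimplexCategory) (α : k ⟶ n) (β : k ⟶ m), Continuous
      fun p : B × stdCosimplex.obj k => f (p.1, stdCosimplex.map α p.2, stdCosimplex.map β p.2)) :
    Continuous f := by
  let k := SimplexCategory.mk (n.len + m.len)
  let : TopologicalSpace ((k ⟶ n) × (k ⟶ m)) := ⊥
  have : DiscreteTopology ((k ⟶ n) × (k ⟶ m)) := ⟨rfl⟩
  -- Finiteness makes the disjoint union of simplices compact, so that `π` is proper.
  have : Finite (k ⟶ n) := Finite.of_injective (fun f => ⇑(SimplexCategory.Hom.toOrderHom f))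
    fun f g h => SimplexCategory.Hom.ext _ _ (OrderHom.ext _ _ h)
  have : Finite (k ⟶ m) := Finite.of_injective (fun f => ⇑(SimplexCategory.Hom.toOrderHom f))
    fun f g h => SimplexCategory.Hom.ext _ _ (OrderHom.ext _ _ h)
  let π : ((k ⟶ n) × (k ⟶ m)) × stdCosimplex.obj k → stdCosimplex.obj n × stdCosimplex.obj m :=
    fun p => (stdCosimplex.map p.1.1 p.2, stdCosimplex.map p.1.2 p.2)
  have hπ : Continuous π := by
    refine continuous_prod_of_discrete_left.2 fun i => ?_
    exact ((stdCosimplex.map i.1).hom.continuous.prodMk (stdCosimplex.map i.2).hom.continuous)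
  have hs : Function.Surjective π := by
    rintro ⟨x, y⟩
    obtain ⟨α, β, z, hx, hy⟩ := exists_stdCosimplex_coupling x y
    exact ⟨((α, β), z), Prod.ext hx hy⟩
  -- A product of a quotient map with `B` need not be a quotient map for general `B`; a proper map
  -- stays closed after taking the product.
  have hq : Topology.IsQuotientMap (Prod.map (id : B → B) π) :=
    ((Homeomorph.refl B).isProperMap.prodMap hπ.isProperMap).isClosedMap.isQuotientMap
      (continuous_id.prodMap hπ) (Function.surjective_id.prodMap hs)
  rw [hq.continuous_iff]
  have hg : Continuous fun q : ((k ⟶ n) × (k ⟶ m)) × B × stdCosimplex.obj k =>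
      f (q.2.1, π (q.1, q.2.2)) :=
    continuous_prod_of_discrete_left.2 fun i => hf k i.1 i.2
  exact hg.comp (g := fun q : ((k ⟶ n) × (k ⟶ m)) × B × stdCosimplex.obj k =>
      f (q.2.1, π (q.1, q.2.2)))
    (f := fun p : B × ((k ⟶ n) × (k ⟶ m)) × stdCosimplex.obj k => (p.2.1, p.1, p.2.2))
    (by fun_prop)

/-! ### Chains and points of homotopy limits -/

section Chains

variable {C : Type} [SmallCategory C]

/-- The action of a simplicial operator on a chain in `C`. -/
abbrev chainRestrict {k n : SimplexCategory} (α : k ⟶ n) (s : Fin (n.len + 1) ⥤ C) :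
    Fin (k.len + 1) ⥤ C :=
  α.toOrderHom.monotone.functor ⋙ s

/-- The morphism from the last object of a restricted chain to the last object of the chain. -/
abbrev chainToLast {k n : SimplexCategory} (α : k ⟶ n) (s : Fin (n.len + 1) ⥤ C) :
    (chainRestrict α s).obj (Fin.last k.len) ⟶ s.obj (Fin.last n.len) :=
  s.map (homOfLE (Fin.le_last (α.toOrderHom (Fin.last k.len))))

lemma chainToLast_comp {l k n : SimplexCategory} (γ : l ⟶ k) (α : k ⟶ n)
    (s : Fin (n.len + 1) ⥤ C) :
    chainToLast (γ ≫ α) s = chainToLast γ (chainRestrict α s) ≫ chainToLast α s := by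
  refine Eq.trans ?_ (s.map_comp _ _)
  exact congrArg s.map (Subsingleton.elim _ _)

lemma chainToLast_id {n : SimplexCategory} (s : Fin (n.len + 1) ⥤ C) :
    chainToLast (𝟙 n) s = 𝟙 _ :=
  s.map_id _

lemma Holim.compat {X : C ⥤ TopCat.{u}} (f : Holim X) {k n : SimplexCategory} (α : k ⟶ n)
    (s : Fin (n.len + 1) ⥤ C) (x : stdCosimplex.obj k) :
    X.map (chainToLast α s) (f.1 k (chainRestrict α s) x) = f.1 n s (stdCosimplex.map α x) :=
  congrArg (fun g => g x) (f.2 α s)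

@[ext]
lemma Holim.ext {X : C ⥤ TopCat.{u}} {f g : Holim X} (h : ∀ n s x, f.1 n s x = g.1 n s x) :
    f = g :=
  Subtype.ext (funext fun n => funext fun s => ContinuousMap.ext fun x => h n s x)

lemma Holim.continuous_eval {X : C ⥤ TopCat.{u}} (n : SimplexCategory)
    (s : Fin (n.len + 1) ⥤ C) :
    Continuous fun p : Holim X × stdCosimplex.obj n => p.1.1 n s p.2 := by
  have h1 : Continuous fun f : Holim X => f.1 n s :=
    (continuous_apply s).comp ((continuous_apply n).comp continuous_subtype_val)
  exact (h1.comp continuous_fst).eval continuous_snd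

lemma Holim.continuous_of_eval {X : C ⥤ TopCat.{u}} {B : Type*} [TopologicalSpace B]
    {F : B → Holim X}
    (h : ∀ n s, Continuous fun p : B × stdCosimplex.obj n => (F p.1).1 n s p.2) :
    Continuous F :=
  Continuous.subtype_mk (continuous_pi fun n => continuous_pi fun s =>
    ContinuousMap.continuous_of_continuous_uncurry _ (h n s)) _

end Chains

/-! ### Fubini for homotopy limits -/

section Fubini

variable {C D : Type} [SmallCategory C] [SmallCategory D]

lemma diagram_map_map_apply (X : C ⥤ TopCat.{u}) {a b c : C} (φ : a ⟶ b) (ψ : b ⟶ c)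
    (x : X.obj a) :
    X.map ψ (X.map φ x) = X.map (φ ≫ ψ) x := by
  rw [X.map_comp]
  rfl

lemma diagram_naturality_apply {X Y : C ⥤ TopCat.{u}} (η : X ⟶ Y) {a b : C} (φ : a ⟶ b)
    (x : X.obj a) :
    Y.map φ (η.app a x) = η.app b (X.map φ x) :=
  congrArg (fun h => h.hom x) (η.naturality φ).symm

lemma diagram_map_id_apply (X : C ⥤ TopCat.{u}) {a : C} (x : X.obj a) : X.map (𝟙 a) x = x := by
  rw [X.map_id]
  rfl

lemma diagram_map_mkHom_apply (Y : C × D ⥤ TopCat.{u}) {c c' : C} {d d' : D}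
    (φ : c ⟶ c') (ψ : d ⟶ d') (y : Y.obj (c, d)) :
    Y.map (X := (c', d)) (Y := (c', d')) (Prod.mkHom (𝟙 c') ψ)
      (Y.map (X := (c, d)) (Y := (c', d)) (Prod.mkHom φ (𝟙 d)) y) =
    Y.map (X := (c, d)) (Y := (c', d')) (Prod.mkHom φ ψ) y := by
  rw [← TopCat.comp_app, ← Y.map_comp]
  simp

/-- The value of a point of an iterated homotopy limit at a pair of chains and a pair of points of
simplices. -/
noncomputable def holimEval₂ {Y : C × D ⥤ TopCat.{u}}
    (f : Holim (Functor.curry.obj Y ⋙ holimFunctor D))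
    {n m : SimplexCategory} (s : Fin (n.len + 1) ⥤ C) (t : Fin (m.len + 1) ⥤ D)
    (x : stdCosimplex.obj n) (y : stdCosimplex.obj m) :
    Y.obj (s.obj (Fin.last _), t.obj (Fin.last _)) :=
  (f.1 n s x : Holim _).1 m t y

/-- The two operators act separately: naturality in `C` comes from the outer homotopy limit,
naturality in `D` from the inner one. -/
lemma holimEval₂_compat {Y : C × D ⥤ TopCat.{u}}
    (f : Holim (Functor.curry.obj Y ⋙ holimFunctor D))
    {k l n m : SimplexCategory} (α : k ⟶ n) (β : l ⟶ m) (s : Fin (n.len + 1) ⥤ C)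
    (t : Fin (m.len + 1) ⥤ D) (x : stdCosimplex.obj k) (y : stdCosimplex.obj l) :
    Y.map (Prod.mkHom (chainToLast α s) (chainToLast β t))
      (holimEval₂ f (chainRestrict α s) (chainRestrict β t) x y) =
    holimEval₂ f s t (stdCosimplex.map α x) (stdCosimplex.map β y) := by
  rw [← diagram_map_mkHom_apply]
  have h1 := congrArg (fun g : Holim _ => g.1 l (chainRestrict β t) y) (Holim.compat f α s x)
  have h2 := Holim.compat (f.1 n s (stdCosimplex.map α x) : Holim _) β t y
  exact (congrArg _ h1).trans h2

lemma continuous_holimEval₂ {Y : C × D ⥤ TopCat.{u}} {n m : SimplexCategory}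
    (s : Fin (n.len + 1) ⥤ C) (t : Fin (m.len + 1) ⥤ D) :
    Continuous fun p : Holim (Functor.curry.obj Y ⋙ holimFunctor D) ×
      stdCosimplex.obj n × stdCosimplex.obj m => holimEval₂ p.1 s t p.2.1 p.2.2 := by
  have h1 : Continuous fun p : Holim (Functor.curry.obj Y ⋙ holimFunctor D) ×
      stdCosimplex.obj n × stdCosimplex.obj m => ((p.1.1 n s p.2.1 : Holim _), p.2.2) :=
    ((Holim.continuous_eval n s).comp (continuous_fst.prodMk
      (continuous_fst.comp continuous_snd))).prodMk (continuous_snd.comp continuous_snd)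
  exact (Holim.continuous_eval (X := (Functor.curry.obj Y).obj _) m t).comp h1

/-- Restriction to the diagonal, from an iterated homotopy limit to the homotopy limit over a
product. -/
noncomputable def holimDiag (Y : C × D ⥤ TopCat.{u})
    (f : Holim (Functor.curry.obj Y ⋙ holimFunctor D)) : Holim Y :=
  ⟨fun _ r => ⟨fun x => holimEval₂ f (r ⋙ CategoryTheory.Prod.fst C D)
    (r ⋙ CategoryTheory.Prod.snd C D) x x,
      (continuous_holimEval₂ _ _).comp
        (continuous_const.prodMk (continuous_id.prodMk continuous_id))⟩,
  fun _ _ α r => ContinuousMap.ext fun x =>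
    holimEval₂_compat f α α (r ⋙ CategoryTheory.Prod.fst C D)
      (r ⋙ CategoryTheory.Prod.snd C D) x x⟩

lemma continuous_holimDiag (Y : C × D ⥤ TopCat.{u}) : Continuous (holimDiag Y) :=
  Holim.continuous_of_eval fun _ _ => (continuous_holimEval₂ _ _).comp
    (continuous_fst.prodMk (continuous_snd.prodMk continuous_snd))

/-- The extension of a point of the homotopy limit over a product to pairs of chains of different
lengths. -/
noncomputable def holimGlue {Y : C × D ⥤ TopCat.{u}} (g : Holim Y) {n m : SimplexCategory}
    (s : Fin (n.len + 1) ⥤ C) (t : Fin (m.len + 1) ⥤ D) (x : stdCosimplex.obj n)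
    (y : stdCosimplex.obj m) : Y.obj (s.obj (Fin.last _), t.obj (Fin.last _)) :=
  glue (fun k α β z => Y.map (Prod.mkHom (chainToLast α s) (chainToLast β t))
    (g.1 k ((chainRestrict α s).prod' (chainRestrict β t)) z)) x y

/-- The characterization of the glued function; compatibility of `g` with simplicial operators is
exactly the gluing condition. -/
lemma holimGlue_map {Y : C × D ⥤ TopCat.{u}} (g : Holim Y) {k n m : SimplexCategory}
    (s : Fin (n.len + 1) ⥤ C) (t : Fin (m.len + 1) ⥤ D) (α : k ⟶ n) (β : k ⟶ m)
    (z : stdCosimplex.obj k) :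
    holimGlue g s t (stdCosimplex.map α z) (stdCosimplex.map β z) =
      Y.map (Prod.mkHom (chainToLast α s) (chainToLast β t))
        (g.1 k ((chainRestrict α s).prod' (chainRestrict β t)) z) := by
  refine glue_map (fun l k γ α β w => ?_) α β z
  rw [← Holim.compat g γ, chainToLast_comp, chainToLast_comp]
  exact (diagram_map_map_apply Y (chainToLast γ ((chainRestrict α s).prod' (chainRestrict β t)))
    (Prod.mkHom (chainToLast α s) (chainToLast β t)) _).symm

lemma continuous_holimGlue {Y : C × D ⥤ TopCat.{u}} {n m : SimplexCategory}
    (s : Fin (n.len + 1) ⥤ C) (t : Fin (m.len + 1) ⥤ D) :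
    Continuous fun p : Holim Y × stdCosimplex.obj n × stdCosimplex.obj m =>
      holimGlue p.1 s t p.2.1 p.2.2 := by
  refine continuous_of_comp_stdCosimplex_map fun k α β => ?_
  simp_rw [holimGlue_map]
  exact (Y.map _).hom.continuous.comp (Holim.continuous_eval k _)

/-- A single coupling of `x` and `y` represents both sides, even though `α` and `β` are unrelated
operators. -/
lemma holimGlue_compat {Y : C × D ⥤ TopCat.{u}} (g : Holim Y) {k l n m : SimplexCategory}
    (α : k ⟶ n) (β : l ⟶ m) (s : Fin (n.len + 1) ⥤ C) (t : Fin (m.len + 1) ⥤ D)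
    (x : stdCosimplex.obj k) (y : stdCosimplex.obj l) :
    Y.map (Prod.mkHom (chainToLast α s) (chainToLast β t))
      (holimGlue g (chainRestrict α s) (chainRestrict β t) x y) =
    holimGlue g s t (stdCosimplex.map α x) (stdCosimplex.map β y) := by
  obtain ⟨α', β', z, rfl, rfl⟩ := exists_stdCosimplex_coupling x y
  rw [stdCosimplex_map_comp_apply, stdCosimplex_map_comp_apply, holimGlue_map, holimGlue_map,
    chainToLast_comp, chainToLast_comp]
  exact diagram_map_map_apply Y _ _ _

lemma holimGlue_compat_right {Y : C × D ⥤ TopCat.{u}} (g : Holim Y) {l n m : SimplexCategory}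
    (β : l ⟶ m) (s : Fin (n.len + 1) ⥤ C) (t : Fin (m.len + 1) ⥤ D)
    (x : stdCosimplex.obj n) (y : stdCosimplex.obj l) :
    Y.map (Prod.mkHom (𝟙 _) (chainToLast β t)) (holimGlue g s (chainRestrict β t) x y) =
    holimGlue g s t x (stdCosimplex.map β y) := by
  have h := holimGlue_compat g (𝟙 n) β s t x y
  rw [chainToLast_id, diagram_map_id_apply stdCosimplex] at h
  exact h

lemma holimGlue_compat_left {Y : C × D ⥤ TopCat.{u}} (g : Holim Y) {k n m : SimplexCategory}
    (α : k ⟶ n) (s : Fin (n.len + 1) ⥤ C) (t : Fin (m.len + 1) ⥤ D)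
    (x : stdCosimplex.obj k) (y : stdCosimplex.obj m) :
    Y.map (Prod.mkHom (chainToLast α s) (𝟙 _)) (holimGlue g (chainRestrict α s) t x y) =
    holimGlue g s t (stdCosimplex.map α x) y := by
  have h := holimGlue_compat g α (𝟙 m) s t x y
  rw [chainToLast_id, diagram_map_id_apply stdCosimplex] at h
  exact h

/-- The extension of a point of the homotopy limit over a product to a point of the iterated
homotopy limit. -/
noncomputable def holimCurry (Y : C × D ⥤ TopCat.{u}) (g : Holim Y) :
    Holim (Functor.curry.obj Y ⋙ holimFunctor D) :=
  ⟨fun _ s => ⟨fun x => ⟨fun _ t => ⟨fun y => holimGlue g s t x y,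
      (continuous_holimGlue s t).comp
        (continuous_const.prodMk (continuous_const.prodMk continuous_id))⟩,
      fun _ _ β t => ContinuousMap.ext fun y => holimGlue_compat_right g β s t x y⟩,
    Holim.continuous_of_eval fun _ t => (continuous_holimGlue s t).comp
      (continuous_const.prodMk (continuous_fst.prodMk continuous_snd))⟩,
  fun _ _ α s => ContinuousMap.ext fun x => Holim.ext fun _ t y =>
    holimGlue_compat_left g α s t x y⟩

lemma continuous_holimCurry (Y : C × D ⥤ TopCat.{u}) : Continuous (holimCurry Y) :=
  Holim.continuous_of_eval fun _ s => Holim.continuous_of_eval fun _ t =>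
    (continuous_holimGlue s t).comp
      ((continuous_fst.comp continuous_fst).prodMk
        ((continuous_snd.comp continuous_fst).prodMk continuous_snd))

/-- The diagonal is the simplex `(𝟙 n, 𝟙 n)` of `Δⁿ × Δⁿ`, where the glued function is the given
one. -/
lemma holimDiag_holimCurry (Y : C × D ⥤ TopCat.{u}) (g : Holim Y) :
    holimDiag Y (holimCurry Y g) = g := by
  refine Holim.ext fun n r x => ?_
  have h := holimGlue_map g (r ⋙ CategoryTheory.Prod.fst C D) (r ⋙ CategoryTheory.Prod.snd C D)
    (𝟙 n) (𝟙 n) x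
  rw [diagram_map_id_apply stdCosimplex, chainToLast_id, chainToLast_id] at h
  exact h.trans (diagram_map_id_apply Y _)

/-- A point of the iterated homotopy limit is determined by its diagonal values, because every pair
`(x, y)` is the image of a diagonal pair `(z, z)`. -/
lemma holimCurry_holimDiag (Y : C × D ⥤ TopCat.{u})
    (f : Holim (Functor.curry.obj Y ⋙ holimFunctor D)) :
    holimCurry Y (holimDiag Y f) = f := by
  refine Holim.ext fun n s x => Holim.ext fun m t y => ?_
  obtain ⟨α, β, z, rfl, rfl⟩ := exists_stdCosimplex_coupling x y
  exact (holimGlue_map (holimDiag Y f) s t α β z).trans (holimEval₂_compat f α β s t z z)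

/-- The homotopy limit over a product is the iterated homotopy limit. -/
noncomputable def holimProdIso (C D : Type) [SmallCategory C] [SmallCategory D] :
    holimFunctor.{u} (C × D) ≅
      Functor.curry ⋙ (Functor.whiskeringRight _ _ _).obj (holimFunctor D) ⋙ holimFunctor C :=
  NatIso.ofComponents
    (fun Y =>
      { hom := TopCat.ofHom ⟨holimCurry Y, continuous_holimCurry Y⟩
        inv := TopCat.ofHom ⟨holimDiag Y, continuous_holimDiag Y⟩
        hom_inv_id := by
          ext g
          exact holimDiag_holimCurry Y g
        inv_hom_id := by
          ext f
          exact holimCurry_holimDiag Y f })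
    fun {X Y} η => by
      ext g
      refine Holim.ext fun n s x => Holim.ext fun m t y => ?_
      obtain ⟨α, β, z, rfl, rfl⟩ := exists_stdCosimplex_coupling x y
      refine (holimGlue_map (Holim.map η g) s t α β z).trans ?_
      refine Eq.trans ?_ (congrArg (η.app (s.obj (Fin.last _), t.obj (Fin.last _)))
        (holimGlue_map g s t α β z)).symm
      exact diagram_naturality_apply η (Prod.mkHom (chainToLast α s) (chainToLast β t)) _

end Fubini

/-! ### Continuity for spaces of natural maps -/

section NatMaps

variable {C : Type} [SmallCategory C]

lemma NatMaps.compat {E : C ⥤ TopCat.{0}} {X : C ⥤ TopCat.{u}} (f : NatMaps E X) {c d : C}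
    (φ : c ⟶ d) (x : E.obj c) : X.map φ (f.1 c x) = f.1 d (E.map φ x) :=
  congrArg (fun g => g x) (f.2 φ)

lemma NatMaps.ext {E : C ⥤ TopCat.{0}} {X : C ⥤ TopCat.{u}} {f g : NatMaps E X}
    (h : ∀ c x, f.1 c x = g.1 c x) : f = g :=
  Subtype.ext (funext fun c => ContinuousMap.ext fun x => h c x)

lemma NatMaps.continuous_apply {E : C ⥤ TopCat.{0}} {X : C ⥤ TopCat.{u}} (c : C) :
    Continuous fun f : NatMaps E X => f.1 c :=
  (_root_.continuous_apply c).comp continuous_subtype_val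

lemma NatMaps.continuous_of_apply {E : C ⥤ TopCat.{0}} {X : C ⥤ TopCat.{u}} {B : Type*}
    [TopologicalSpace B] {G : B → NatMaps E X} (h : ∀ c, Continuous fun b => (G b).1 c) :
    Continuous G :=
  Continuous.subtype_mk (continuous_pi h) _

lemma NatMaps.continuous_eval {E : C ⥤ TopCat.{0}} {X : C ⥤ TopCat.{u}} (c : C)
    [LocallyCompactSpace (E.obj c)] :
    Continuous fun p : NatMaps E X × E.obj c => p.1.1 c p.2 :=
  ((NatMaps.continuous_apply c).comp continuous_fst).eval continuous_snd

lemma NatMaps.continuous_of_eval {E : C ⥤ TopCat.{0}} {X : C ⥤ TopCat.{u}} {B : Type*}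
    [TopologicalSpace B] {G : B → NatMaps E X}
    (h : ∀ c, Continuous fun p : B × E.obj c => (G p.1).1 c p.2) : Continuous G :=
  NatMaps.continuous_of_apply fun c => ContinuousMap.continuous_of_continuous_uncurry _ (h c)

end NatMaps

/-! ### Fubini for spaces of natural maps -/

section Fubini

variable {C D : Type} [SmallCategory C] [SmallCategory D]

/-- The external product of two diagrams of spaces. -/
def externalProd (E : C ⥤ TopCat.{0}) (F : D ⥤ TopCat.{0}) : C × D ⥤ TopCat.{0} where
  obj p := TopCat.of (E.obj p.1 × F.obj p.2)
  map φ := TopCat.ofHom ((E.map φ.1).hom.prodMap (F.map φ.2).hom)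
  map_id p := by
    refine TopCat.hom_ext (ContinuousMap.ext fun x => ?_)
    exact Prod.ext (diagram_map_id_apply E x.1) (diagram_map_id_apply F x.2)
  map_comp φ ψ := by
    refine TopCat.hom_ext (ContinuousMap.ext fun x => ?_)
    exact Prod.ext (diagram_map_map_apply E φ.1 ψ.1 x.1).symm
      (diagram_map_map_apply F φ.2 ψ.2 x.2).symm

variable {E : C ⥤ TopCat.{0}} {F : D ⥤ TopCat.{0}}

instance externalProd_locallyCompactSpace [∀ c, LocallyCompactSpace (E.obj c)]
    [∀ d, LocallyCompactSpace (F.obj d)] (p : C × D) :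
    LocallyCompactSpace ((externalProd E F).obj p) :=
  inferInstanceAs (LocallyCompactSpace (E.obj p.1 × F.obj p.2))

instance externalProd_t2Space [∀ c, T2Space (E.obj c)] [∀ d, T2Space (F.obj d)] (p : C × D) :
    T2Space ((externalProd E F).obj p) :=
  inferInstanceAs (T2Space (E.obj p.1 × F.obj p.2))

/-- The value of a point of an iterated space of natural maps at a pair of points. -/
def natMapsEval₂ {Y : C × D ⥤ TopCat.{u}} (f : NatMaps E (Functor.curry.obj Y ⋙ natMapsFunctor F))
    (c : C) (d : D) (x : E.obj c) (y : F.obj d) : Y.obj (c, d) :=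
  (f.1 c x : NatMaps F _).1 d y

lemma natMapsEval₂_compat {Y : C × D ⥤ TopCat.{u}}
    (f : NatMaps E (Functor.curry.obj Y ⋙ natMapsFunctor F)) {c c' : C} {d d' : D}
    (φ : c ⟶ c') (ψ : d ⟶ d') (x : E.obj c) (y : F.obj d) :
    Y.map (Prod.mkHom φ ψ) (natMapsEval₂ f c d x y) =
      natMapsEval₂ f c' d' (E.map φ x) (F.map ψ y) := by
  rw [← diagram_map_mkHom_apply]
  have h1 := congrArg (fun g : NatMaps F _ => g.1 d y) (NatMaps.compat f φ x)
  have h2 := NatMaps.compat (f.1 c' (E.map φ x) : NatMaps F _) ψ y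
  exact (congrArg _ h1).trans h2

lemma continuous_natMapsEval₂ [∀ c, LocallyCompactSpace (E.obj c)]
    [∀ d, LocallyCompactSpace (F.obj d)] {Y : C × D ⥤ TopCat.{u}} (c : C) (d : D) :
    Continuous fun p : NatMaps E (Functor.curry.obj Y ⋙ natMapsFunctor F) × E.obj c × F.obj d =>
      natMapsEval₂ p.1 c d p.2.1 p.2.2 := by
  have h1 : Continuous fun p : NatMaps E (Functor.curry.obj Y ⋙ natMapsFunctor F) ×
      E.obj c × F.obj d => ((p.1.1 c p.2.1 : NatMaps F _), p.2.2) :=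
    ((NatMaps.continuous_eval c).comp (continuous_fst.prodMk
      (continuous_fst.comp continuous_snd))).prodMk (continuous_snd.comp continuous_snd)
  exact (NatMaps.continuous_eval (X := (Functor.curry.obj Y).obj _) d).comp h1

/-- A natural map on an external product, as an iterated natural map. -/
def natMapsCurry (Y : C × D ⥤ TopCat.{u}) (g : NatMaps (externalProd E F) Y) :
    NatMaps E (Functor.curry.obj Y ⋙ natMapsFunctor F) :=
  ⟨fun c => ⟨fun x => ⟨fun d => ⟨fun y => g.1 (c, d) (x, y),
      (g.1 (c, d)).continuous.comp (continuous_const.prodMk continuous_id)⟩,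
      fun d d' ψ => ContinuousMap.ext fun y => by
        have h := NatMaps.compat g (Prod.mkHom (𝟙 c) ψ) (x, y)
        exact h.trans (congrArg (fun x' => g.1 (c, d') (x', F.map ψ y)) (diagram_map_id_apply E x))⟩,
    NatMaps.continuous_of_eval fun d => (g.1 (c, d)).continuous⟩,
  fun c c' φ => ContinuousMap.ext fun x => NatMaps.ext fun d y => by
    have h := NatMaps.compat g (Prod.mkHom φ (𝟙 d)) (x, y)
    exact h.trans (congrArg (fun y' => g.1 (c', d) (E.map φ x, y')) (diagram_map_id_apply F y))⟩

variable [∀ c, LocallyCompactSpace (E.obj c)] [∀ d, LocallyCompactSpace (F.obj d)]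

/-- Local compactness enters through the joint continuity of evaluation. -/
lemma continuous_natMapsCurry (Y : C × D ⥤ TopCat.{u}) :
    Continuous (natMapsCurry (E := E) (F := F) Y) :=
  NatMaps.continuous_of_eval fun c => NatMaps.continuous_of_eval fun d =>
    (NatMaps.continuous_eval (E := externalProd E F) (X := Y) (c, d)).comp
      ((continuous_fst.comp continuous_fst).prodMk
        ((continuous_snd.comp continuous_fst).prodMk continuous_snd))

/-- An iterated natural map, as a natural map on an external product. -/
def natMapsUncurry (Y : C × D ⥤ TopCat.{u})
    (f : NatMaps E (Functor.curry.obj Y ⋙ natMapsFunctor F)) : NatMaps (externalProd E F) Y :=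
  ⟨fun p => ⟨fun x => natMapsEval₂ f p.1 p.2 x.1 x.2,
      (continuous_natMapsEval₂ _ _).comp (continuous_const.prodMk continuous_id)⟩,
    fun _ _ φ => ContinuousMap.ext fun x => natMapsEval₂_compat f φ.1 φ.2 x.1 x.2⟩

lemma continuous_natMapsUncurry (Y : C × D ⥤ TopCat.{u}) :
    Continuous (natMapsUncurry (E := E) (F := F) Y) :=
  NatMaps.continuous_of_eval fun p => continuous_natMapsEval₂ p.1 p.2

/-- The space of natural maps on an external product is the iterated space of natural maps. -/
def natMapsProdIso (E : C ⥤ TopCat.{0}) (F : D ⥤ TopCat.{0})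
    [∀ c, LocallyCompactSpace (E.obj c)] [∀ d, LocallyCompactSpace (F.obj d)] :
    natMapsFunctor.{u} (externalProd E F) ≅
      Functor.curry ⋙ (Functor.whiskeringRight _ _ _).obj (natMapsFunctor F) ⋙ natMapsFunctor E :=
  NatIso.ofComponents
    (fun Y =>
      { hom := TopCat.ofHom ⟨natMapsCurry Y, continuous_natMapsCurry Y⟩
        inv := TopCat.ofHom ⟨natMapsUncurry Y, continuous_natMapsUncurry Y⟩
        hom_inv_id := rfl
        inv_hom_id := rfl })
    fun _ => rfl

end Fubini

/-! ### Reindexing along isomorphisms of categories -/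

section Reindexing

variable {C D : Type} [SmallCategory C] [SmallCategory D]

/-- Restriction of homotopy limits along a functor. -/
noncomputable def holimRestrict (G : C ⥤ D) :
    holimFunctor.{u} D ⟶ (Functor.whiskeringLeft _ _ _).obj G ⋙ holimFunctor C where
  app Y := TopCat.ofHom
    { toFun f := ⟨fun n s => f.1 n (s ⋙ G), fun _ _ α s => f.2 α (s ⋙ G)⟩
      continuous_toFun := Holim.continuous_of_eval fun n s => Holim.continuous_eval n (s ⋙ G) }

/-- Restriction along `G` lands in the homotopy limit of `G ⋙ Y`, not of `Y`. Keeping `G` a variable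
with an equation allows substitution, after which the map is an identity. -/
lemma isIso_holimRestrict_app_of_eq_id {G : C ⥤ C} (h : G = 𝟭 C) (Y : C ⥤ TopCat.{u}) :
    IsIso ((holimRestrict G).app Y) := by
  subst h
  exact inferInstanceAs (IsIso (𝟙 _))

/-- Restriction of natural maps along a functor. -/
def natMapsRestrict (G : C ⥤ D) (E : D ⥤ TopCat.{0}) :
    natMapsFunctor.{u} E ⟶
      (Functor.whiskeringLeft _ _ _).obj G ⋙ natMapsFunctor (G ⋙ E) where
  app Y := TopCat.ofHom
    { toFun f := ⟨fun c => f.1 (G.obj c), fun _ _ φ => f.2 (G.map φ)⟩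
      continuous_toFun := NatMaps.continuous_of_apply fun c => NatMaps.continuous_apply (G.obj c) }

lemma isIso_natMapsRestrict_app_of_eq_id {G : C ⥤ C} (h : G = 𝟭 C) (E : C ⥤ TopCat.{0})
    (Y : C ⥤ TopCat.{u}) : IsIso ((natMapsRestrict G E).app Y) := by
  subst h
  exact inferInstanceAs (IsIso (𝟙 _))

/-- Part of the two-out-of-six property. It avoids identifying the restriction along `H` as an
inverse, which would require transport along equalities of functors. -/
lemma isIso_of_isIso_comp {A : Type*} [Category* A] {a b c d : A} (f : a ⟶ b) (g : b ⟶ c)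
    (h : c ⟶ d) [IsIso (f ≫ g)] [IsIso (g ≫ h)] : IsIso f := by
  have : Mono g := mono_of_mono g h
  have : IsSplitEpi g := IsSplitEpi.mk' ⟨inv (f ≫ g) ≫ f, by simp⟩
  have : IsIso g := isIso_of_mono_of_isSplitEpi g
  exact IsIso.of_isIso_comp_right f g

lemma isIso_holimRestrict {G : C ⥤ D} {H : D ⥤ C} (h₁ : G ⋙ H = 𝟭 C) (h₂ : H ⋙ G = 𝟭 D) :
    IsIso (holimRestrict.{u} G) := by
  have : ∀ Y, IsIso ((holimRestrict.{u} G).app Y) := by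
    intro Y
    have i₁ : IsIso ((holimRestrict.{u} G).app Y ≫ (holimRestrict H).app (G ⋙ Y)) :=
      isIso_holimRestrict_app_of_eq_id h₂ Y
    have i₂ : IsIso ((holimRestrict H).app (G ⋙ Y) ≫ (holimRestrict G).app (H ⋙ G ⋙ Y)) :=
      isIso_holimRestrict_app_of_eq_id h₁ (G ⋙ Y)
    exact isIso_of_isIso_comp _ ((holimRestrict H).app (G ⋙ Y))
      ((holimRestrict G).app (H ⋙ G ⋙ Y))
  exact NatIso.isIso_of_isIso_app _

lemma isIso_natMapsRestrict {G : C ⥤ D} {H : D ⥤ C} (h₁ : G ⋙ H = 𝟭 C) (h₂ : H ⋙ G = 𝟭 D)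
    (E : D ⥤ TopCat.{0}) : IsIso (natMapsRestrict.{u} G E) := by
  have : ∀ Y, IsIso ((natMapsRestrict.{u} G E).app Y) := by
    intro Y
    have i₁ : IsIso ((natMapsRestrict.{u} G E).app Y ≫
        (natMapsRestrict H (G ⋙ E)).app (G ⋙ Y)) :=
      isIso_natMapsRestrict_app_of_eq_id h₂ E Y
    have i₂ : IsIso ((natMapsRestrict H (G ⋙ E)).app (G ⋙ Y) ≫
        (natMapsRestrict G (H ⋙ G ⋙ E)).app (H ⋙ G ⋙ Y)) :=
      isIso_natMapsRestrict_app_of_eq_id h₁ (G ⋙ E) (G ⋙ Y)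
    exact isIso_of_isIso_comp _ ((natMapsRestrict H (G ⋙ E)).app (G ⋙ Y))
      ((natMapsRestrict G (H ⋙ G ⋙ E)).app (H ⋙ G ⋙ Y))
  exact NatIso.isIso_of_isIso_app _

/-- Precomposition of natural maps with an isomorphism of diagrams. -/
def natMapsPrecompIso {E F : C ⥤ TopCat.{0}} (e : E ≅ F) :
    natMapsFunctor.{u} F ≅ natMapsFunctor.{u} E :=
  let pre {E F : C ⥤ TopCat.{0}} (η : E ⟶ F) : natMapsFunctor.{u} F ⟶ natMapsFunctor.{u} E :=
    { app := fun Y => TopCat.ofHom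
        { toFun f := ⟨fun c => (f.1 c).comp (η.app c).hom, fun c d φ =>
            ContinuousMap.ext fun x => (NatMaps.compat f φ (η.app c x)).trans
              (congrArg (f.1 d) (diagram_naturality_apply η φ x))⟩
          continuous_toFun := NatMaps.continuous_of_apply fun c =>
            (ContinuousMap.continuous_precomp _).comp (NatMaps.continuous_apply c) } }
  { hom := pre e.hom
    inv := pre e.inv
    hom_inv_id := by
      ext Y f
      refine NatMaps.ext fun c x => congrArg (f.1 c) ?_
      exact congrArg (fun h => h.hom x) (e.inv_hom_id_app c)
    inv_hom_id := by
      ext Y f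
      refine NatMaps.ext fun c x => congrArg (f.1 c) ?_
      exact congrArg (fun h => h.hom x) (e.hom_inv_id_app c) }

end Reindexing

/-! ### The empty list of variables -/

section Point

lemma punit_map_apply (Y : Discrete PUnit.{1} ⥤ TopCat.{u}) (φ : Discrete.mk PUnit.unit ⟶ ⟨⟨⟩⟩)
    (y : Y.obj ⟨⟨⟩⟩) : Y.map φ y = y := by
  obtain rfl : φ = 𝟙 _ := Subsingleton.elim _ _
  exact diagram_map_id_apply Y y

/-- The homotopy limit over a one-point category is the evaluation. -/
noncomputable def holimPUnitIso :
    holimFunctor.{u} (Discrete PUnit.{1}) ≅ (evaluation _ _).obj ⟨PUnit.unit⟩ :=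
  NatIso.ofComponents
    (fun Y =>
      { hom := TopCat.ofHom
          { toFun f := f.1 (.mk 0) ((Functor.const _).obj ⟨⟨⟩⟩) (default : stdSimplex ℝ (Fin 1))
            continuous_toFun := (Holim.continuous_eval _ _).comp
              (continuous_id.prodMk continuous_const) }
        inv := TopCat.ofHom
          { toFun y := ⟨fun n s => ContinuousMap.const _ y, fun _ _ _ _ =>
              ContinuousMap.ext fun _ => punit_map_apply Y _ y⟩
            continuous_toFun := Holim.continuous_of_eval fun _ _ => continuous_fst }
        hom_inv_id := by
          refine TopCat.hom_ext (ContinuousMap.ext fun f => Holim.ext fun n s x => ?_)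
          -- The operator `n ⟶ [0]` collapses the simplex, so `f` is constant with the value at the
          -- vertex.
          have h := Holim.compat f (X := Y) (SimplexCategory.Hom.mk ⟨fun _ => 0, monotone_const⟩ :
            n ⟶ .mk 0) ((Functor.const _).obj ⟨⟨⟩⟩) x
          refine Eq.trans ?_ (h.symm.trans (punit_map_apply Y _ _))
          exact congrArg (f.1 (.mk 0) ((Functor.const _).obj ⟨⟨⟩⟩))
            (Subsingleton.elim (α := stdSimplex ℝ (Fin 1)) _ _)
        inv_hom_id := rfl })
    fun _ => rfl

/-- The space of natural maps from a point over a one-point category is the evaluation. -/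
def natMapsPUnitIso :
    natMapsFunctor.{u} ((Functor.const (Discrete PUnit.{1})).obj (TopCat.of PUnit.{1})) ≅
      (evaluation _ _).obj ⟨PUnit.unit⟩ :=
  NatIso.ofComponents
    (fun Y =>
      { hom := TopCat.ofHom
          { toFun f := f.1 ⟨⟨⟩⟩ PUnit.unit
            continuous_toFun := (continuous_eval_const PUnit.unit).comp
              (NatMaps.continuous_apply (X := Y) ⟨⟨⟩⟩) }
        inv := TopCat.ofHom
          { toFun y := ⟨fun _ => ContinuousMap.const _ y, fun _ _ _ =>
              ContinuousMap.ext fun _ => punit_map_apply Y _ y⟩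
            continuous_toFun := NatMaps.continuous_of_eval fun _ => continuous_fst }
        hom_inv_id := rfl
        inv_hom_id := rfl })
    fun _ => rfl

end Point

/-! ### Lists of variables and the iterated constructions -/

section Lists

variable {ι : Type} (j : ι → ℕ)

/-- The product of the truncated simplex categories of the variables in a list. -/
def TruncList : List ι → Type
  | [] => Discrete PUnit.{1}
  | a :: l => SimplexCategory.Truncated (j a) × TruncList l

instance truncListCategory : ∀ l : List ι, SmallCategory (TruncList j l)
  | [] => inferInstanceAs (SmallCategory (Discrete PUnit.{1}))
  | a :: l =>
    let _ := truncListCategory l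
    inferInstanceAs (SmallCategory (SimplexCategory.Truncated (j a) × TruncList j l))

/-- The values of the variables in a list. -/
def evalList : (l : List ι) → (∀ i, SimplexCategory.Truncated (j i)) ⥤ TruncList j l
  | [] => (Functor.const _).obj (show Discrete PUnit.{1} from ⟨⟨⟩⟩)
  | a :: l => (Pi.eval _ a).prod' (evalList l)

/-- The product of simplices indexed by the variables in a list. -/
noncomputable def listSimplex : (l : List ι) → TruncList j l ⥤ TopCat.{0}
  | [] => (Functor.const (Discrete PUnit.{1})).obj (TopCat.of PUnit.{1})
  | a :: l => externalProd (SimplexCategory.Truncated.inclusion (j a) ⋙ stdCosimplex)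
      (listSimplex l)

instance (k : ℕ) (p : SimplexCategory.Truncated k) :
    T2Space ((SimplexCategory.Truncated.inclusion k ⋙ stdCosimplex).obj p) :=
  inferInstanceAs (T2Space (stdCosimplex.obj p.1))

instance (k : ℕ) (p : SimplexCategory.Truncated k) :
    LocallyCompactSpace ((SimplexCategory.Truncated.inclusion k ⋙ stdCosimplex).obj p) :=
  inferInstanceAs (LocallyCompactSpace (stdCosimplex.obj p.1))

instance listSimplex_t2Space : ∀ (l : List ι) (q : TruncList j l), T2Space ((listSimplex j l).obj q)
  | [], _ => inferInstanceAs (T2Space PUnit)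
  | a :: l, q =>
    have := listSimplex_t2Space l
    externalProd_t2Space (E := SimplexCategory.Truncated.inclusion (j a) ⋙ stdCosimplex) q

instance listSimplex_locallyCompactSpace :
    ∀ (l : List ι) (q : TruncList j l), LocallyCompactSpace ((listSimplex j l).obj q)
  | [], _ => inferInstanceAs (LocallyCompactSpace PUnit)
  | a :: l, q =>
    have := listSimplex_locallyCompactSpace l
    externalProd_locallyCompactSpace
      (E := SimplexCategory.Truncated.inclusion (j a) ⋙ stdCosimplex) q

/-- The projection of the product of all simplices to the product of those in a list. -/
noncomputable def simplexProj : (l : List ι) →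
    (truncIncl j ⋙ multiSimplex ι ⟶ evalList j l ⋙ listSimplex j l)
  | [] => { app := fun _ => TopCat.ofHom (ContinuousMap.const _ PUnit.unit) }
  | a :: l =>
    { app := fun p => TopCat.ofHom ⟨fun x => (x a, (simplexProj l).app p x),
        (continuous_apply a).prodMk ((simplexProj l).app p).hom.continuous⟩
      naturality := fun p q φ => TopCat.hom_ext (ContinuousMap.ext fun x =>
        Prod.ext rfl (diagram_naturality_apply (simplexProj l) φ x).symm) }

lemma simplexProj_eq_iff (l : List ι) (p : ∀ i, SimplexCategory.Truncated (j i))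
    (x y : (truncIncl j ⋙ multiSimplex ι).obj p) :
    (simplexProj j l).app p x = (simplexProj j l).app p y ↔ ∀ i ∈ l, x i = y i := by
  induction l with
  | nil => exact ⟨fun _ _ h => (List.not_mem_nil h).elim, fun _ => rfl⟩
  | cons a l ih =>
    rw [List.forall_mem_cons, ← ih]
    exact Prod.ext_iff

variable [DecidableEq ι]

/-- The value of one of the variables in a list. -/
def projList : (l : List ι) → (i : ι) → i ∈ l → (TruncList j l ⥤ SimplexCategory.Truncated (j i))
  | [], _, h => (List.not_mem_nil h).elim
  | a :: l, i, h =>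
    if hi : i = a then
      hi ▸ CategoryTheory.Prod.fst (SimplexCategory.Truncated (j a)) (TruncList j l)
    else CategoryTheory.Prod.snd (SimplexCategory.Truncated (j a)) (TruncList j l) ⋙
      projList l i (List.mem_of_ne_of_mem hi h)

lemma projList_cons_self (a : ι) (l : List ι) (h : a ∈ a :: l) :
    projList j (a :: l) a h =
      CategoryTheory.Prod.fst (SimplexCategory.Truncated (j a)) (TruncList j l) :=
  dif_pos rfl

lemma projList_cons_of_ne {a i : ι} {l : List ι} (hi : i ≠ a) (h : i ∈ a :: l) :
    projList j (a :: l) i h =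
      CategoryTheory.Prod.snd (SimplexCategory.Truncated (j a)) (TruncList j l) ⋙
        projList j l i (List.mem_of_ne_of_mem hi h) :=
  dif_neg hi

lemma evalList_comp_projList (l : List ι) (i : ι) (h : i ∈ l) :
    evalList j l ⋙ projList j l i h = Pi.eval _ i := by
  induction l with
  | nil => exact (List.not_mem_nil h).elim
  | cons a l ih =>
    by_cases hi : i = a
    · subst hi
      rw [projList_cons_self]
      rfl
    · rw [projList_cons_of_ne j hi]
      exact ih _

/-- `projList` reads the first occurrence of a variable only; without repetitions these readings
determine a functor into `TruncList j l`. -/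
lemma comp_evalList_eq {Q : Type} [SmallCategory Q] (l : List ι) (hl : l.Nodup)
    (K : Q ⥤ ∀ i, SimplexCategory.Truncated (j i)) (L : Q ⥤ TruncList j l)
    (h : ∀ i hi, K ⋙ Pi.eval _ i = L ⋙ projList j l i hi) : K ⋙ evalList j l = L := by
  induction l with
  | nil => exact Functor.punit_ext' _ _
  | cons a l ih =>
    have h1 : K ⋙ Pi.eval _ a =
        L ⋙ CategoryTheory.Prod.fst (SimplexCategory.Truncated (j a)) (TruncList j l) := by
      rw [h a List.mem_cons_self, projList_cons_self]
    have h2 : K ⋙ evalList j l =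
        L ⋙ CategoryTheory.Prod.snd (SimplexCategory.Truncated (j a)) (TruncList j l) := by
      refine ih hl.of_cons _ fun i hi => ?_
      rw [h i (List.mem_cons_of_mem _ hi),
        projList_cons_of_ne j (fun hia : i = a => (List.nodup_cons.1 hl).1 (hia ▸ hi))]
      rfl
    exact congrArg₂ Functor.prod' h1 h2

/-- The values of all variables, read off from a list containing them. -/
def unevalList {l : List ι} (h : ∀ i, i ∈ l) :
    TruncList j l ⥤ ∀ i, SimplexCategory.Truncated (j i) :=
  Functor.pi' fun i => projList j l i (h i)

lemma evalList_comp_unevalList {l : List ι} (h : ∀ i, i ∈ l) :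
    evalList j l ⋙ unevalList j h = 𝟭 _ :=
  Functor.pi_ext _ _ fun i => evalList_comp_projList j l i (h i)

lemma unevalList_comp_evalList {l : List ι} (hl : l.Nodup) (h : ∀ i, i ∈ l) :
    unevalList j h ⋙ evalList j l = 𝟭 _ :=
  comp_evalList_eq j l hl _ _ fun _ _ => rfl

/-- The values of all variables, from values of the variables outside a list and values of the
variables in the list. -/
def combineVars : (l : List ι) →
    ({i : ι // i ∉ l} → SimplexCategory) × TruncList j l ⥤ (ι → SimplexCategory)
  | [] => CategoryTheory.Prod.fst _ _ ⋙ Functor.pi' fun i => Pi.eval _ ⟨i, List.not_mem_nil⟩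
  | a :: l =>
    (((CategoryTheory.Prod.fst _ (SimplexCategory.Truncated (j a) × TruncList j l)).prod'
      (CategoryTheory.Prod.snd _ (SimplexCategory.Truncated (j a) × TruncList j l) ⋙
        CategoryTheory.Prod.fst _ _ ⋙ SimplexCategory.Truncated.inclusion (j a)) ⋙
      insertVar a l).prod'
      (CategoryTheory.Prod.snd _ (SimplexCategory.Truncated (j a) × TruncList j l) ⋙
        CategoryTheory.Prod.snd _ _)) ⋙ combineVars l

/-- The functor `p` is general so that the induction can absorb the variable `a` into it. -/
lemma nonempty_combineVars_iso (l : List ι)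
    (p : (∀ i, SimplexCategory.Truncated (j i)) ⥤ ({i : ι // i ∉ l} → SimplexCategory))
    (e : ∀ i : {i : ι // i ∉ l}, Nonempty
      (p ⋙ Pi.eval _ i ≅ Pi.eval _ i.1 ⋙ SimplexCategory.Truncated.inclusion (j i.1))) (i : ι) :
    Nonempty ((p.prod' (evalList j l) ⋙ combineVars j l) ⋙ Pi.eval _ i ≅
      Pi.eval _ i ⋙ SimplexCategory.Truncated.inclusion (j i)) := by
  induction l with
  | nil => exact e ⟨i, List.not_mem_nil⟩
  | cons a l ih =>
    refine ih (p.prod' (Pi.eval _ a ⋙ SimplexCategory.Truncated.inclusion (j a)) ⋙ insertVar a l)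
      fun i => ?_
    by_cases hi : i.1 = a
    · obtain ⟨i, hil⟩ := i
      obtain rfl : i = a := hi
      have h : insertVar i l ⋙ Pi.eval _ ⟨i, hil⟩ = CategoryTheory.Prod.snd _ _ :=
        (Functor.pi'_eval _ _).trans (dif_pos rfl)
      rw [Functor.assoc, h]
      exact ⟨Iso.refl _⟩
    · have h : insertVar a l ⋙ Pi.eval _ i = CategoryTheory.Prod.fst _ _ ⋙
          Pi.eval _ ⟨i.1, fun h => (List.mem_cons.1 h).elim hi i.2⟩ :=
        (Functor.pi'_eval _ _).trans (dif_neg hi)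
      rw [Functor.assoc, h]
      exact e ⟨i.1, _⟩

lemma nonempty_combineVars_iso_truncIncl {l : List ι} (h : ∀ i, i ∈ l)
    (p : {i : ι // i ∉ l} → SimplexCategory) :
    Nonempty (((Functor.const _).obj p).prod' (evalList j l) ⋙ combineVars j l ≅ truncIncl j) := by
  have e := nonempty_combineVars_iso j l ((Functor.const _).obj p) fun i => (i.2 (h i.1)).elim
  exact ⟨NatIso.pi' fun i => (e i).some⟩

/-- A construction on diagrams indexed by `TruncList j l`, applied to the variables in `l` of a
multicosimplicial space. -/
def inVariables (l : List ι) (S : (TruncList j l ⥤ TopCat.{u}) ⥤ TopCat.{u}) :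
    MultiCosimplicialSpace.{u} ι ⥤ MultiCosimplicialSpace.{u} {i : ι // i ∉ l} :=
  (Functor.whiskeringLeft _ _ _).obj (combineVars j l) ⋙ Functor.curry ⋙
    (Functor.whiskeringRight _ _ _).obj S

/-- Currying commutes with inserting a variable. -/
def curryCombineVarsIso (a : ι) (l : List ι) :
    (Functor.whiskeringLeft _ _ TopCat.{u}).obj (combineVars j l) ⋙ Functor.curry ⋙
      (Functor.whiskeringLeft _ _ _).obj (insertVar a l) ⋙ Functor.curry ⋙
        (Functor.whiskeringRight _ _ _).obj
          ((Functor.whiskeringLeft _ _ _).obj (SimplexCategory.Truncated.inclusion (j a))) ≅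
    (Functor.whiskeringLeft _ _ TopCat.{u}).obj (combineVars j (a :: l)) ⋙ Functor.curry ⋙
      (Functor.whiskeringRight _ _ _).obj
        (Functor.curry (C := SimplexCategory.Truncated (j a)) (D := TruncList j l)) :=
  NatIso.ofComponents
    (fun X => NatIso.ofComponents
      (fun p => NatIso.ofComponents
        (fun q₀ => NatIso.ofComponents (fun q => Iso.refl _) fun {q q'} ψ => by
          refine (Category.comp_id _).trans (Eq.trans ?_ (Category.id_comp _).symm)
          -- The two maps differ only in whether an identity is first sent through `insertVar a l`.
          exact congrArg (fun x => X.map ((combineVars j l).map (Prod.mkHom x ψ)))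
            ((insertVar a l).map_id _).symm)
        fun φ => by
          ext q x
          rfl)
      fun φ => by
        ext q₀ q x
        rfl)
    fun η => by
      ext p q₀ q x
      rfl

/-- Iterated constructions in the variables of a list amount to a construction on diagrams indexed
by `TruncList j l` that is compatible with products of the index categories. -/
def iterVariablesIso (T : ∀ k, (SimplexCategory.Truncated k ⥤ TopCat.{u}) ⥤ TopCat.{u})
    (S : ∀ l : List ι, (TruncList j l ⥤ TopCat.{u}) ⥤ TopCat.{u})
    (e₀ : S [] ≅ (evaluation (Discrete PUnit.{1}) _).obj ⟨PUnit.unit⟩)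
    (e : ∀ a l, S (a :: l) ≅ Functor.curry (C := SimplexCategory.Truncated (j a))
      (D := TruncList j l) ⋙ (Functor.whiskeringRight _ _ _).obj (S l) ⋙ T (j a)) :
    ∀ l, iterVariables (fun k => (Functor.whiskeringLeft _ _ _).obj
      (SimplexCategory.Truncated.inclusion k) ⋙ T k) j l ≅ inVariables j l (S l)
  | [] => (Functor.isoWhiskerLeft ((Functor.whiskeringLeft _ _ _).obj (combineVars j []) ⋙
      Functor.curry) ((Functor.whiskeringRight _ _ _).mapIso e₀)).symm
  | a :: l =>
    Functor.isoWhiskerRight (iterVariablesIso T S e₀ e l) (inVariable _ a l) ≪≫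
    Functor.isoWhiskerRight (curryCombineVarsIso j a l)
      ((Functor.whiskeringRight _ _ _).obj
        ((Functor.whiskeringRight _ _ _).obj (S l) ⋙ T (j a))) ≪≫
    (Functor.isoWhiskerLeft ((Functor.whiskeringLeft _ _ _).obj (combineVars j (a :: l)) ⋙
      Functor.curry) ((Functor.whiskeringRight _ _ _).mapIso (e a l))).symm

/-- A construction in all variables at once agrees with the iterated construction if both are
compatible with the passage to lists of variables. -/
lemma exists_iterated_iso {m : ℕ} (j : Fin m → ℕ) (σ : Equiv.Perm (Fin m))
    (T : ∀ k, (SimplexCategory.Truncated k ⥤ TopCat.{u}) ⥤ TopCat.{u})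
    (S : ∀ l : List (Fin m), (TruncList j l ⥤ TopCat.{u}) ⥤ TopCat.{u})
    (S' : ((∀ i, SimplexCategory.Truncated (j i)) ⥤ TopCat.{u}) ⥤ TopCat.{u})
    (e₀ : S [] ≅ (evaluation (Discrete PUnit.{1}) _).obj ⟨PUnit.unit⟩)
    (e : ∀ a l, S (a :: l) ≅ Functor.curry (C := SimplexCategory.Truncated (j a))
      (D := TruncList j l) ⋙ (Functor.whiskeringRight _ _ _).obj (S l) ⋙ T (j a))
    (e' : ∀ l : List (Fin m), l.Nodup → (∀ i, i ∈ l) →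
      Nonempty (S l ≅ (Functor.whiskeringLeft _ _ _).obj (evalList j l) ⋙ S')) :
    Nonempty ((Functor.whiskeringLeft _ _ _).obj (truncIncl j) ⋙ S' ≅
      iterated (fun k => (Functor.whiskeringLeft _ _ _).obj
        (SimplexCategory.Truncated.inclusion k) ⋙ T k) j σ) := by
  have hσ : ∀ i, i ∈ List.ofFn σ := fun i => (List.mem_ofFn' σ i).2 (σ.surjective i)
  obtain ⟨e'⟩ := e' (List.ofFn σ) (List.nodup_ofFn.2 σ.injective) hσ
  -- No variable lies outside the list, so this is the only point, the one used in `iterated`.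
  let p : {i : Fin m // i ∉ List.ofFn σ} → SimplexCategory := fun i => (i.2 (hσ i.1)).elim
  obtain ⟨κ⟩ := nonempty_combineVars_iso_truncIncl j hσ p
  have e₁ : (Functor.whiskeringLeft _ _ TopCat.{u}).obj (truncIncl j) ⋙ S' ≅
      ((Functor.whiskeringLeft _ _ TopCat.{u}).obj (combineVars j (List.ofFn σ)) ⋙
        Functor.curry ⋙ (evaluation _ _).obj p) ⋙
      (Functor.whiskeringLeft _ _ _).obj (evalList j (List.ofFn σ)) ⋙ S' :=
    Functor.isoWhiskerRight ((Functor.whiskeringLeft _ _ TopCat.{u}).mapIso κ.symm) S'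
  have e₂ : iterated (fun k => (Functor.whiskeringLeft _ _ _).obj
      (SimplexCategory.Truncated.inclusion k) ⋙ T k) j σ ≅
      ((Functor.whiskeringLeft _ _ TopCat.{u}).obj (combineVars j (List.ofFn σ)) ⋙
        Functor.curry ⋙ (evaluation _ _).obj p) ⋙ S (List.ofFn σ) :=
    Functor.isoWhiskerRight (iterVariablesIso j T S e₀ e (List.ofFn σ)) ((evaluation _ _).obj p)
  exact ⟨e₁ ≪≫ (Functor.isoWhiskerLeft _ e').symm ≪≫ e₂.symm⟩

lemma simplexProj_surjective (l : List ι) (hl : l.Nodup)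
    (p : ∀ i, SimplexCategory.Truncated (j i)) :
    Function.Surjective ((simplexProj j l).app p) := by
  induction l with
  | nil =>
    intro y
    exact ⟨fun i => (Classical.arbitrary (SimplexCategory.toTop₀.obj (p i).1)), rfl⟩
  | cons a l ih =>
    rintro ⟨u, v⟩
    obtain ⟨x, rfl⟩ := ih hl.of_cons v
    refine ⟨Function.update x a u, Prod.ext (Function.update_self _ _ _) ?_⟩
    refine (simplexProj_eq_iff j l p _ _).2 fun i hi => Function.update_of_ne ?_ _ _
    exact fun hia => (List.nodup_cons.1 hl).1 (hia ▸ hi)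

/-- A continuous bijection from a compact space to a Hausdorff space. Injectivity needs every
variable to occur; surjectivity needs no repetition, as a repeated variable would only give a
diagonal. -/
lemma isIso_simplexProj {l : List ι} (hl : l.Nodup) (h : ∀ i, i ∈ l) :
    IsIso (simplexProj j l) := by
  have : ∀ p, IsIso ((simplexProj j l).app p) := by
    intro p
    have : CompactSpace ((truncIncl j ⋙ multiSimplex ι).obj p) :=
      inferInstanceAs (CompactSpace (∀ i, stdCosimplex.obj (p i).1))
    have : T2Space ((evalList j l ⋙ listSimplex j l).obj p) :=
      listSimplex_t2Space j l _
    have hb : Function.Bijective ((simplexProj j l).app p) :=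
      ⟨fun x y hxy => funext fun i => (simplexProj_eq_iff j l p x y).1 hxy i (h i),
        simplexProj_surjective j l hl p⟩
    exact (TopCat.isoOfHomeo (Continuous.homeoOfEquivCompactToT2 (f := Equiv.ofBijective _ hb)
      ((simplexProj j l).app p).hom.continuous)).isIso_hom
  exact NatIso.isIso_of_isIso_app _

end Lists

/-! ### The two definitions of the totalization -/

lemma isHomotopyEquiv_of_isIso {A B : TopCat.{u}} (f : A ⟶ B) [IsIso f] : IsHomotopyEquiv f :=
  ⟨(TopCat.homeoOfIso (asIso f)).toHomotopyEquiv, rfl⟩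

/-- Besides the index category, the diagram of simplices has to be changed, from the full product to
the iterated binary product. -/
lemma nonempty_mapTot_iso {m : ℕ} (j : Fin m → ℕ) (σ : Equiv.Perm (Fin m)) :
    Nonempty (mapTot.{u} j ≅ iterated mapTotOne.{u} j σ) := by
  refine exists_iterated_iso j σ
    (fun k => natMapsFunctor (SimplexCategory.Truncated.inclusion k ⋙ stdCosimplex))
    (fun l => natMapsFunctor (listSimplex j l)) (natMapsFunctor (truncIncl j ⋙ multiSimplex _))
    natMapsPUnitIso (fun a l => natMapsProdIso _ _) fun l hl h => ?_
  have := isIso_natMapsRestrict.{u} (evalList_comp_unevalList j h)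
    (unevalList_comp_evalList j hl h) (listSimplex j l)
  have := isIso_simplexProj j hl h
  exact ⟨asIso (natMapsRestrict (evalList j l) (listSimplex j l)) ≪≫
    Functor.isoWhiskerLeft _ (natMapsPrecompIso (asIso (simplexProj j l)))⟩

lemma nonempty_holimTot_iso {m : ℕ} (j : Fin m → ℕ) (σ : Equiv.Perm (Fin m)) :
    Nonempty (holimTot.{u} j ≅ iterated holimTotOne.{u} j σ) := by
  refine exists_iterated_iso j σ (fun k => holimFunctor (SimplexCategory.Truncated k))
    (fun l => holimFunctor (TruncList j l)) (holimFunctor _)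
    holimPUnitIso (fun a l => holimProdIso _ _) fun l hl h => ?_
  have := isIso_holimRestrict.{u} (evalList_comp_unevalList j h) (unevalList_comp_evalList j hl h)
  exact ⟨asIso (holimRestrict (evalList j l))⟩

end MultiTot

theorem propositionP (m : ℕ) (j : Fin m → ℕ) (σ : Equiv.Perm (Fin m)) :
    (∃ τ : MultiTot.mapTot.{u} j ⟶ MultiTot.iterated MultiTot.mapTotOne.{u} j σ,
      ∀ X : MultiTot.MultiCosimplicialSpace.{u} (Fin m), MultiTot.IsHomotopyEquiv (τ.app X)) ∧
    (∃ τ : MultiTot.holimTot.{u} j ⟶ MultiTot.iterated MultiTot.holimTotOne.{u} j σ,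
      ∀ X : MultiTot.MultiCosimplicialSpace.{u} (Fin m), MultiTot.IsHomotopyEquiv (τ.app X)) := by
  obtain ⟨e⟩ := MultiTot.nonempty_mapTot_iso.{u} j σ
  obtain ⟨e'⟩ := MultiTot.nonempty_holimTot_iso.{u} j σ
  exact ⟨⟨e.hom, fun X => MultiTot.isHomotopyEquiv_of_isIso _⟩,
    ⟨e'.hom, fun X => MultiTot.isHomotopyEquiv_of_isIso _⟩⟩
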